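/- Let $q$ be a complex number with $0<|q|<1$. Write $(x;q)_\infty=\prod_{i\ge 0}(1-xq^i)$, $(x;q)_n=\prod_{i=0}^{n-1}(1-xq^i)$ and $(x_1,\dots,x_r;q)_n=(x_1;q)_n\cdots(x_r;q)_n$ (likewise with $n=\infty$). Let $$\theta(q,x)=\sum_{n=0}^{\infty}(-1)^nq^{\binom n2}x^n,\qquad P_4(a,b)=(q,a,b;q)_\infty\sum_{n=0}^\infty\frac{(ab/q^4;q)_{2n}}{(q,a,b,ab/q^4;q)_n}\,q^n .$$ The series $\theta(q,x)$ converges for every $x\in\mathbb C$. Let $a\in\mathbb C$ be such that no denominator in the series for $P_4(a,-a)$ vanishes, i.e. $aq^i\ne1$, $-aq^i\neq 1$ and $-a^2q^{i-4}\ne 1$ for all integers $i\ge0$. Then the series in $P_4(a,-a)$ converges and $$\frac{a^2-aq-aq^3+q^5}{2q^2(1+q+q^2)}\,\theta(q,a)+\frac{a^2+aq+aq^3+q^5}{2q^2(1+q+q^2)}\,\theta(q,-a)+1=\frac{(1+q)(1+q^2)}{1+q+q^2}\,P_4(a,-a).$$ Moreover, for every $a\in\mathbb C$, all $x\neq a$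 sufficiently close to $a$ satisfy these non-vanishing conditions, $\lim_{x\to a,\,x\ne a}P_4(x,-x)$ exists, and the same identity holds with $P_4(a,-a)$ replaced by this limit; so the identity holds for every complex $a$ if $P_4(a,-a)$ is understood as this limit at the exceptional points. -/

import Mathlib

open Filter Topology

noncomputable section

namespace PartialThetaId

/-- The infinite `q`-shifted factorial `(x; q)_∞ = ∏_{i ≥ 0} (1 - x q^i)`. -/
def qfacInf (x q : ℂ) : ℂ := ∏' i : ℕ, (1 - x * q ^ i)

/-- The product defining `(x; q)_∞` converges for `|q| < 1`. -/
theorem multipliable_qfacInf (x q : ℂ) (hq : ‖q‖ < 1) :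
    Multipliable (fun i : ℕ => 1 - x * q ^ i) := by
  have h : Summable (fun i : ℕ => ‖-(x * q ^ i)‖) := by
    simpa [norm_mul, norm_pow] using
      (summable_geometric_of_lt_one (norm_nonneg q) hq).mul_left ‖x‖
  simpa [sub_eq_add_neg] using multipliable_one_add_of_summable h

/-- The finite `q`-shifted factorial `(x; q)_n = ∏_{i < n} (1 - x q^i)`. -/
def qfac (x q : ℂ) (n : ℕ) : ℂ := ∏ i ∈ Finset.range n, (1 - x * q ^ i)

/-- The `n`-th term of the partial theta series. -/
def thetaTerm (q x : ℂ) (n : ℕ) : ℂ := (-1) ^ n * q ^ (n.choose 2) * x ^ n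

/-- The partial theta function `θ(q, x) = ∑_{n ≥ 0} (-1)^n q^(n choose 2) x^n`. -/
def theta (q x : ℂ) : ℂ := ∑' n : ℕ, thetaTerm q x n

/-- The `n`-th term
`(ab/q^m; q)_{2n} / ((q; q)_n (a; q)_n (b; q)_n (ab/q^m; q)_n) * q^n` of the series in `P_m(a, b)`. -/
def PTerm (q : ℂ) (m : ℕ) (a b : ℂ) (n : ℕ) : ℂ :=
  qfac (a * b / q ^ m) q (2 * n) /
    (qfac q q n * qfac a q n * qfac b q n * qfac (a * b / q ^ m) q n) * q ^ n

/-- `P_m(a, b) = (q; q)_∞ (a; q)_∞ (b; q)_∞ ∑_{n ≥ 0} (PTerm of index n)`. -/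
def P (q : ℂ) (m : ℕ) (a b : ℂ) : ℂ :=
  qfacInf q q * qfacInf a q * qfacInf b q * ∑' n : ℕ, PTerm q m a b n

/-- No denominator in the series `P_m(a, b)` vanishes. -/
def Admissible (q : ℂ) (m : ℕ) (a b : ℂ) : Prop :=
  ∀ i : ℕ, a * q ^ i ≠ 1 ∧ b * q ^ i ≠ 1 ∧ a * b / q ^ m * q ^ i ≠ 1

end PartialThetaId

end

noncomputable section

namespace PartialThetaId

/-! Put $z=a^2$. Since $(a,-a;q)_n=(z;q^2)_n$, the infinite products absorb the denominators, and
$P_4(a,-a)=(q;q)_\infty\sum_n\frac{q^n}{(q;q)_n}(-zq^{n-4};q)_n(zq^{2n};q^2)_\infty$ (`PTerm_eq`).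
The $q$-binomial theorem and Euler's expansion turn this into an absolutely convergent triple series
in $i,j,m$ with $n=j+m$. Summing over $m$ first gives $(q;q)_{j+2i}/(q;q)_\infty$
(`exists_hasSum_tripleTerm`), so the coefficient of $z^k$, $k=i+j$, is a finite sum.

That sum is a power of $q$ times $\sum_i\frac{(q^{-k},q^{k+1};q)_i}{(q^2;q^2)_i}q^{3i}$. With $q^i$
in place of $q^{3i}$ it is a $q$-Vandermonde sum (`sum_vanRatio_mul_pow`), and two telescoping
relations raise the exponent to $3i$. The resulting powers of $q$ are those of the even and odd
parts of $\theta$ (`theta_combination`).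

At exceptional points the theta side is continuous and equals the $P_4$ side on a punctured
neighbourhood. -/

/-! ### Finite $q$-factorials and the $q$-binomial theorem -/

theorem qfac_zero (x q : ℂ) : qfac x q 0 = 1 := by simp [qfac]

theorem qfac_succ (x q : ℂ) (n : ℕ) : qfac x q (n + 1) = qfac x q n * (1 - x * q ^ n) := by
  simp [qfac, Finset.prod_range_succ]

theorem qfac_add (x q : ℂ) (m n : ℕ) :
    qfac x q (m + n) = qfac x q m * qfac (x * q ^ m) q n := by
  simp [qfac, Finset.prod_range_add, pow_add, mul_assoc]

theorem one_sub_pow_ne_zero {q : ℂ} (hq : ‖q‖ < 1) {n : ℕ} (hn : n ≠ 0) : 1 - q ^ n ≠ 0 := by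
  intro h
  have h1 : ‖q ^ n‖ = 1 := by rw [← sub_eq_zero.1 h, norm_one]
  rw [norm_pow] at h1
  exact (pow_lt_one₀ (norm_nonneg q) hq hn).ne h1

theorem qfac_self_ne_zero {q : ℂ} (hq : ‖q‖ < 1) (n : ℕ) : qfac q q n ≠ 0 := by
  refine Finset.prod_ne_zero_iff.2 fun i _ => ?_
  rw [← pow_succ']
  exact one_sub_pow_ne_zero hq i.succ_ne_zero

theorem norm_sq_lt_one {q : ℂ} (hq : ‖q‖ < 1) : ‖q ^ 2‖ < 1 := by
  rw [norm_pow]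
  exact pow_lt_one₀ (norm_nonneg q) hq two_ne_zero

/-- The finite `q`-binomial theorem, in symmetric form. -/
theorem sum_antidiagonal_qbinomial {q : ℂ} (hq : ‖q‖ < 1) (y : ℂ) (n : ℕ) :
    ∑ p ∈ Finset.HasAntidiagonal.antidiagonal n, y ^ p.1 * q ^ p.1.choose 2 / qfac q q p.1 / qfac q q p.2 =
      qfac (-y) q n / qfac q q n := by
  induction n with
  | zero => simp [qfac_zero]
  | succ n ih =>
    set f : ℕ × ℕ → ℂ := fun p => y ^ p.1 * q ^ p.1.choose 2 / qfac q q p.1 / qfac q q p.2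
    have hn := one_sub_pow_ne_zero hq n.succ_ne_zero
    -- On $p_1+p_2=n+1$ the weight $1-q^{n+1}$ splits as $(1-q^{p_2})+q^{p_2}(1-q^{p_1})$; each part
    -- cancels one denominator factor and reduces to level $n$.
    have hfst : ∑ p ∈ Finset.HasAntidiagonal.antidiagonal (n + 1), (1 - q ^ p.2) * f p =
        ∑ p ∈ Finset.HasAntidiagonal.antidiagonal n, f p := by
      rw [Finset.Nat.sum_antidiagonal_succ']
      simp only [pow_zero, sub_self, zero_mul, zero_add]
      refine Finset.sum_congr rfl fun p _ => ?_
      have := qfac_self_ne_zero hq p.1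
      have := qfac_self_ne_zero hq p.2
      have := one_sub_pow_ne_zero hq p.2.succ_ne_zero
      simp only [f, qfac_succ, ← pow_succ']
      field_simp
    have hsnd : ∑ p ∈ Finset.HasAntidiagonal.antidiagonal (n + 1), q ^ p.2 * (1 - q ^ p.1) * f p =
        y * q ^ n * ∑ p ∈ Finset.HasAntidiagonal.antidiagonal n, f p := by
      rw [Finset.Nat.sum_antidiagonal_succ, Finset.mul_sum]
      simp only [pow_zero, sub_self, zero_mul, mul_zero, zero_add]
      refine Finset.sum_congr rfl fun p hp => ?_
      have := qfac_self_ne_zero hq p.1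
      have := qfac_self_ne_zero hq p.2
      have := one_sub_pow_ne_zero hq p.1.succ_ne_zero
      have hc : (p.1 + 1).choose 2 = p.1 + p.1.choose 2 := by
        rw [Nat.choose_succ_succ' p.1 1, Nat.choose_one_right]
      simp only [f, qfac_succ, ← pow_succ', hc, ← Finset.HasAntidiagonal.mem_antidiagonal.1 hp]
      field_simp
      ring
    have hsum : (1 - q ^ (n + 1)) * ∑ p ∈ Finset.HasAntidiagonal.antidiagonal (n + 1), f p =
        (1 + y * q ^ n) * ∑ p ∈ Finset.HasAntidiagonal.antidiagonal n, f p := by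
      rw [add_mul, one_mul, ← hsnd, ← hfst, ← Finset.sum_add_distrib, Finset.mul_sum]
      refine Finset.sum_congr rfl fun p hp => ?_
      rw [← Finset.HasAntidiagonal.mem_antidiagonal.1 hp]
      ring
    have := qfac_self_ne_zero hq n
    rw [ih] at hsum
    rw [qfac_succ, qfac_succ, ← pow_succ', ← mul_right_inj' hn, hsum]
    field_simp
    ring

/-! ### Terminating $q$-Vandermonde sums -/

/-- The ratio `(q^(-k), q^(k+1); q)_i / (q^2; q^2)_i`. -/
def vanRatio (q : ℂ) (k i : ℕ) : ℂ :=
  ∏ l ∈ Finset.range i, (1 - q ^ l / q ^ k) * (1 - q ^ (k + 1 + l)) / (1 - q ^ (2 * l + 2))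

theorem vanRatio_zero (q : ℂ) (k : ℕ) : vanRatio q k 0 = 1 := by simp [vanRatio]

theorem vanRatio_succ (q : ℂ) (k i : ℕ) : vanRatio q k (i + 1) =
    vanRatio q k i * ((1 - q ^ i / q ^ k) * (1 - q ^ (k + 1 + i)) / (1 - q ^ (2 * i + 2))) := by
  simp only [vanRatio, Finset.prod_range_succ]

theorem vanRatio_succ_self {q : ℂ} (hq0 : q ≠ 0) (k : ℕ) : vanRatio q k (k + 1) = 0 := by
  simp [vanRatio_succ, hq0]

theorem vanRatio_succ_mul {q : ℂ} (hq0 : q ≠ 0) (hq : ‖q‖ < 1) (k i : ℕ) :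
    vanRatio q k (i + 1) * (1 - q ^ (2 * i + 2)) =
      vanRatio q k i * (1 - ((q ^ k)⁻¹ + q ^ (k + 1)) * q ^ i + q ^ (2 * i + 1)) := by
  have := one_sub_pow_ne_zero hq (2 * i + 1).succ_ne_zero
  rw [vanRatio_succ, mul_assoc, div_mul_cancel₀ _ this]
  field_simp
  ring

/-- Telescopes `vanRatio q k i * (1 - q ^ (2 * i))`, which vanishes at $i=0$. For $n=k$ the right
side is zero, which relates the sums weighted by $q^{2i}$ and $q^i$. -/
theorem sum_vanRatio_first {q : ℂ} (hq0 : q ≠ 0) (hq : ‖q‖ < 1) (k n : ℕ) :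
    ∑ i ∈ Finset.range (n + 1), vanRatio q k i *
        ((1 + q) * q ^ (2 * i) - ((q ^ k)⁻¹ + q ^ (k + 1)) * q ^ i) =
      vanRatio q k (n + 1) * (1 - q ^ (2 * n + 2)) := by
  induction n with
  | zero =>
    rw [vanRatio_succ_mul hq0 hq]
    simp [vanRatio_zero]
    ring
  | succ n ih =>
    rw [Finset.sum_range_succ, ih, vanRatio_succ_mul hq0 hq _ (n + 1)]
    ring

/-- The same telescoping with an extra factor $q^i$, which brings in the weight $q^{3i}$. -/
theorem sum_vanRatio_second {q : ℂ} (hq0 : q ≠ 0) (hq : ‖q‖ < 1) (k n : ℕ) :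
    ∑ i ∈ Finset.range (n + 1), vanRatio q k i *
        ((1 + q ^ 2) * q ^ (3 * i) - q * ((q ^ k)⁻¹ + q ^ (k + 1)) * q ^ (2 * i)
          - (1 - q) * q ^ i) =
      vanRatio q k (n + 1) * (1 - q ^ (2 * n + 2)) * q ^ (n + 1) := by
  induction n with
  | zero =>
    rw [vanRatio_succ_mul hq0 hq]
    simp [vanRatio_zero]
    ring
  | succ n ih =>
    rw [Finset.sum_range_succ, ih, vanRatio_succ_mul hq0 hq _ (n + 1)]
    ring

/-- The ratio `(q^(-k), q^(k+2); q)_i / (q^2; q^2)_i`, the certificate for the recurrence in `k`. -/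
def vanCert (q : ℂ) (k i : ℕ) : ℂ :=
  ∏ l ∈ Finset.range i, (1 - q ^ l / q ^ k) * (1 - q ^ (k + 2 + l)) / (1 - q ^ (2 * l + 2))

theorem vanCert_succ (q : ℂ) (k i : ℕ) : vanCert q k (i + 1) =
    vanCert q k i * ((1 - q ^ i / q ^ k) * (1 - q ^ (k + 2 + i)) / (1 - q ^ (2 * i + 2))) := by
  simp only [vanCert, Finset.prod_range_succ]

theorem vanRatio_eq_vanCert {q : ℂ} (hq : ‖q‖ < 1) (k i : ℕ) :
    vanRatio q k (i + 1) =
      (1 - q ^ i / q ^ k) * (1 - q ^ (k + 1)) / (1 - q ^ (2 * i + 2)) * vanCert q k i := by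
  induction i with
  | zero => simp [vanRatio_succ, vanRatio_zero, vanCert]
  | succ i ih =>
    have h1 := one_sub_pow_ne_zero hq (2 * i + 1).succ_ne_zero
    have h2 := one_sub_pow_ne_zero hq (2 * (i + 1) + 1).succ_ne_zero
    rw [vanRatio_succ, ih, vanCert_succ, show k + 2 + i = k + 1 + (i + 1) by ring]
    ring

theorem vanRatio_succ_eq_vanCert {q : ℂ} (hq0 : q ≠ 0) (k i : ℕ) :
    vanRatio q (k + 1) (i + 1) =
      (1 - (q ^ (k + 1))⁻¹) * (1 - q ^ (k + 2 + i)) / (1 - q ^ (2 * i + 2)) * vanCert q k i := by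
  induction i with
  | zero => simp [vanRatio_succ, vanRatio_zero, vanCert]
  | succ i ih =>
    have h : q ^ (i + 1) / q ^ (k + 1) = q ^ i / q ^ k := by
      field_simp
      ring
    rw [vanRatio_succ, ih, vanCert_succ, h, show k + 1 + 1 + (i + 1) = k + 2 + (i + 1) by ring]
    ring

/-- A Zeilberger-type recurrence in $k$: both ratios are multiples of `vanCert`, so the difference
telescopes. `vanCert q k n` vanishes for $n>k$. -/
theorem sum_vanRatio_recurrence {q : ℂ} (hq0 : q ≠ 0) (hq : ‖q‖ < 1) (k n : ℕ) :
    ∑ i ∈ Finset.range (n + 1), q ^ i * (vanRatio q (k + 1) i / q ^ (k + 1) - vanRatio q k i) =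
      (1 - q ^ (k + 1)) / q ^ (k + 1) * vanCert q k n := by
  induction n with
  | zero =>
    simp [vanRatio_zero, vanCert]
    field_simp
  | succ n ih =>
    have h1 := one_sub_pow_ne_zero hq (2 * n + 1).succ_ne_zero
    rw [Finset.sum_range_succ, ih, vanRatio_succ_eq_vanCert hq0, vanRatio_eq_vanCert hq,
      vanCert_succ]
    have : q ^ k ≠ 0 := pow_ne_zero _ hq0
    rw [show 2 * n + 2 = 2 * n + 1 + 1 by ring] at *
    field_simp
    ring

/-- The $q$-Vandermonde sum ${}_2\phi_1(q^{-k},q^{k+1};-q;q,q)$, as $(q^2;q^2)_i=(q,-q;q)_i$. -/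
theorem sum_vanRatio_mul_pow {q : ℂ} (hq0 : q ≠ 0) (hq : ‖q‖ < 1) (k : ℕ) :
    ∑ i ∈ Finset.range (k + 1), vanRatio q k i * q ^ i = q ^ (k + 1).choose 2 := by
  induction k with
  | zero => simp [vanRatio_zero]
  | succ k ih =>
    have h := sum_vanRatio_recurrence hq0 hq k (k + 1)
    have hk : q ^ (k + 1) ≠ 0 := pow_ne_zero _ hq0
    have h0 : vanCert q k (k + 1) = 0 := by simp [vanCert_succ, hq0]
    have hs : ∑ i ∈ Finset.range (k + 1 + 1), vanRatio q k i * q ^ i = q ^ (k + 1).choose 2 := by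
      rw [Finset.sum_range_succ, ih, vanRatio_succ_self hq0, zero_mul, add_zero]
    have he : ∑ i ∈ Finset.range (k + 1 + 1),
          q ^ i * (vanRatio q (k + 1) i / q ^ (k + 1) - vanRatio q k i) =
        (∑ i ∈ Finset.range (k + 1 + 1), vanRatio q (k + 1) i * q ^ i) / q ^ (k + 1) -
          ∑ i ∈ Finset.range (k + 1 + 1), vanRatio q k i * q ^ i := by
      rw [Finset.sum_div, ← Finset.sum_sub_distrib]
      exact Finset.sum_congr rfl fun i _ => by ring
    rw [he, hs, h0, mul_zero, sub_eq_zero, div_eq_iff hk] at h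
    rw [h, Nat.choose_succ_succ' (k + 1) 1, Nat.choose_one_right, ← pow_add, add_comm]

theorem one_add_pow_ne_zero {q : ℂ} (hq : ‖q‖ < 1) {n : ℕ} (hn : n ≠ 0) : 1 + q ^ n ≠ 0 := by
  have h := one_sub_pow_ne_zero hq (mul_ne_zero hn two_ne_zero)
  rw [pow_mul, show 1 - (q ^ n) ^ 2 = (1 + q ^ n) * (1 - q ^ n) by ring] at h
  exact left_ne_zero_of_mul h

/-- The terminating sum `∑ (q^(-k), q^(k+1); q)_i / (q^2; q^2)_i q^(3i)`. -/
theorem sum_vanRatio_mul_pow_three {q : ℂ} (hq0 : q ≠ 0) (hq : ‖q‖ < 1) (k : ℕ) :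
    (1 + q) * (1 + q ^ 2) * ∑ i ∈ Finset.range (k + 1), vanRatio q k i * q ^ (3 * i) =
      q ^ (k + 1).choose 2 * (q * (q ^ (2 * k))⁻¹ + 1 + q ^ 2 + q ^ (2 * k + 3)) := by
  have h1 := sum_vanRatio_mul_pow hq0 hq k
  have h2 := sum_vanRatio_first hq0 hq k k
  have h3 := sum_vanRatio_second hq0 hq k k
  rw [vanRatio_succ_self hq0] at h2 h3
  simp only [zero_mul, mul_sub, Finset.sum_sub_distrib, mul_left_comm (vanRatio _ _ _),
    ← Finset.mul_sum] at h2 h3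
  rw [h1] at h2 h3
  -- With $A=q^{-k}+q^{k+1}$, eliminating the $q^{2i}$ sum leaves the factor $qA^2+1-q^2$.
  have hA : q * ((q ^ k)⁻¹ + q ^ (k + 1)) ^ 2 + (1 - q) * (1 + q) =
      q * (q ^ (2 * k))⁻¹ + 1 + q ^ 2 + q ^ (2 * k + 3) := by
    have : q ^ k ≠ 0 := pow_ne_zero _ hq0
    rw [mul_comm 2 k, pow_mul]
    field_simp
    ring
  rw [← hA]
  linear_combination (1 + q) * h3 + q * ((q ^ k)⁻¹ + q ^ (k + 1)) * h2

/-! ### The coefficient of $z^k$ -/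

/-- With $k=i+j$, $(q;q)_{k+i}/(q;q)_{k-i}=\prod_{l<i}(1-q^{k-l})(1-q^{k+1+l})$; writing
$1-q^{k-l}=-q^{k-l}(1-q^{l-k})$ yields the sign and powers. -/
theorem qfac_div_eq_vanRatio {q : ℂ} (hq0 : q ≠ 0) (hq : ‖q‖ < 1) (i j : ℕ) :
    (-1) ^ i * q ^ i.choose 2 * qfac q q (j + 2 * i) / (qfac (q ^ 2) (q ^ 2) i * qfac q q j) =
      vanRatio q (i + j) i * q ^ (i * (i + j)) := by
  induction i generalizing j with
  | zero => simp [qfac_zero, vanRatio_zero, qfac_self_ne_zero hq]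
  | succ i ih =>
    -- Taking $j+1$ keeps $i+j$, hence the parameter $k$, fixed.
    have h := ih (j + 1)
    have h1 := qfac_self_ne_zero hq j
    have h2 := qfac_self_ne_zero (norm_sq_lt_one hq) i
    have h3 := one_sub_pow_ne_zero hq j.succ_ne_zero
    have h4 := one_sub_pow_ne_zero hq (2 * i + 1).succ_ne_zero
    have hij : q ^ (i + 1 + j) = q ^ i * q ^ (j + 1) := by ring
    have e1 : j + 2 * (i + 1) = j + 1 + 2 * i + 1 := by ring
    have e2 : q ^ 2 * (q ^ 2) ^ i = q ^ (2 * i + 2) := by ring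
    have e3 : (i + 1).choose 2 = i + i.choose 2 := by
      rw [Nat.choose_succ_succ' i 1, Nat.choose_one_right]
    rw [show i + (j + 1) = i + 1 + j by ring] at h
    rw [e1, qfac_succ q q (j + 1 + 2 * i), qfac_succ (q ^ 2), e2, vanRatio_succ,
      show (i + 1) * (i + 1 + j) = i * (i + 1 + j) + (i + 1 + j) by ring,
      pow_add q (i * (i + 1 + j))]
    rw [qfac_succ q q j, ← pow_succ'] at h
    have h' : vanRatio q (i + 1 + j) i * ((1 - q ^ i / q ^ (i + 1 + j)) *
          (1 - q ^ (i + 1 + j + 1 + i)) / (1 - q ^ (2 * i + 2))) *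
          (q ^ (i * (i + 1 + j)) * q ^ (i + 1 + j)) =
        (vanRatio q (i + 1 + j) i * q ^ (i * (i + 1 + j))) * ((1 - q ^ i / q ^ (i + 1 + j)) *
          (1 - q ^ (i + 1 + j + 1 + i)) / (1 - q ^ (2 * i + 2)) * q ^ (i + 1 + j)) := by ring
    rw [h', ← h, e3, hij]
    have h5 : q ^ i ≠ 0 := pow_ne_zero _ hq0
    have h6 : q ^ (j + 1) ≠ 0 := pow_ne_zero _ hq0
    rw [show 1 - q ^ i / (q ^ i * q ^ (j + 1)) = -(1 - q ^ (j + 1)) / q ^ (j + 1) by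
      field_simp; ring]
    rw [show 2 * i + 2 = 2 * i + 1 + 1 by ring, show q * q ^ (j + 1 + 2 * i) =
      q ^ (i + 1 + j + 1 + i) by ring]
    field_simp
    ring

/-- The coefficient extraction identity behind the evaluation of `P_4(a, -a)`. -/
theorem sum_antidiagonal_coeff {q : ℂ} (hq0 : q ≠ 0) (hq : ‖q‖ < 1) (k : ℕ) :
    (1 + q) * (1 + q ^ 2) * ∑ p ∈ Finset.HasAntidiagonal.antidiagonal k,
        (-1) ^ p.1 * q ^ (2 * p.1.choose 2) * (q ^ p.2.choose 2 / q ^ (4 * p.2)) *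
          q ^ (p.2 * (p.2 + 2 * p.1 + 1)) *
          (qfac q q (p.2 + 2 * p.1) / (qfac (q ^ 2) (q ^ 2) p.1 * qfac q q p.2)) =
      q ^ (2 * k ^ 2 + k) / q ^ (4 * k) *
        (q * (q ^ (2 * k))⁻¹ + 1 + q ^ 2 + q ^ (2 * k + 3)) := by
  have key : ∀ p ∈ Finset.HasAntidiagonal.antidiagonal k,
      (-1) ^ p.1 * q ^ (2 * p.1.choose 2) * (q ^ p.2.choose 2 / q ^ (4 * p.2)) *
          q ^ (p.2 * (p.2 + 2 * p.1 + 1)) *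
          (qfac q q (p.2 + 2 * p.1) / (qfac (q ^ 2) (q ^ 2) p.1 * qfac q q p.2)) =
        q ^ (k ^ 2 + (k + 1).choose 2) / q ^ (4 * k) *
          (vanRatio q k p.1 * q ^ (3 * p.1)) := by
    rintro ⟨i, j⟩ hp
    obtain rfl : i + j = k := Finset.HasAntidiagonal.mem_antidiagonal.1 hp
    have h := qfac_div_eq_vanRatio hq0 hq i j
    have hi : q ^ i.choose 2 ≠ 0 := pow_ne_zero _ hq0
    have hij : q ^ (i * (i + j)) ≠ 0 := pow_ne_zero _ hq0
    have hv : vanRatio q (i + j) i = (-1) ^ i * q ^ i.choose 2 * (qfac q q (j + 2 * i) /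
        (qfac (q ^ 2) (q ^ 2) i * qfac q q j)) / q ^ (i * (i + j)) := by
      rw [eq_div_iff hij, ← h]
      ring
    have hc : ∀ n : ℕ, 2 * n.choose 2 + n = n ^ 2 := by
      intro n
      induction n with
      | zero => rfl
      | succ n ih => rw [Nat.choose_succ_succ' n 1, Nat.choose_one_right]; linarith
    have he : 2 * i.choose 2 + j.choose 2 + j * (j + 2 * i + 1) + 4 * i + i * (i + j) =
        (i + j) ^ 2 + (i + j + 1).choose 2 + i.choose 2 + 3 * i := by
      have h1 := hc i
      have h2 := hc j
      have h3 := hc (i + j + 1)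
      zify at *
      linarith
    have he' : q ^ (2 * i.choose 2) * q ^ j.choose 2 * q ^ (j * (j + 2 * i + 1)) * q ^ (4 * i) *
        q ^ (i * (i + j)) =
        q ^ ((i + j) ^ 2 + (i + j + 1).choose 2) * q ^ i.choose 2 * q ^ (3 * i) := by
      simp only [← pow_add]
      rw [he]
    simp only
    rw [hv, mul_add 4 i j, pow_add q (4 * i)]
    generalize qfac q q (j + 2 * i) / (qfac (q ^ 2) (q ^ 2) i * qfac q q j) = Q
    have h4 : q ^ (4 * i) ≠ 0 := pow_ne_zero _ hq0
    have h5 : q ^ (4 * j) ≠ 0 := pow_ne_zero _ hq0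
    rw [show (-1) ^ i * q ^ (2 * i.choose 2) * (q ^ j.choose 2 / q ^ (4 * j)) *
        q ^ (j * (j + 2 * i + 1)) * Q = (q ^ (2 * i.choose 2) * q ^ j.choose 2 *
        q ^ (j * (j + 2 * i + 1)) * q ^ (4 * i) * q ^ (i * (i + j))) * ((-1) ^ i * Q) /
        (q ^ (4 * i) * q ^ (4 * j) * q ^ (i * (i + j))) by
      rw [eq_div_iff (by positivity)]; rw [mul_div_assoc']; field_simp, he']
    field_simp
  rw [Finset.sum_congr rfl key, ← Finset.mul_sum,
    Finset.Nat.sum_antidiagonal_eq_sum_range_succ_mk]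
  have h := sum_vanRatio_mul_pow_three hq0 hq k
  have hk : 2 * k ^ 2 + k = k ^ 2 + (k + 1).choose 2 + (k + 1).choose 2 := by
    have : ∀ n : ℕ, 2 * (n + 1).choose 2 = n ^ 2 + n := by
      intro n
      induction n with
      | zero => rfl
      | succ n ih => rw [Nat.choose_succ_succ' (n + 1) 1, Nat.choose_one_right]; linarith
    have := this k
    omega
  rw [hk, pow_add q (k ^ 2 + _)]
  linear_combination q ^ (k ^ 2 + (k + 1).choose 2) / q ^ (4 * k) * h

/-! ### Convergence and continuity -/

theorem summable_of_ratio_tendsto {f c : ℕ → ℂ} {l : ℂ} (hf : ∀ n, f (n + 1) = c n * f n)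
    (hc : Tendsto c atTop (𝓝 l)) (hl : ‖l‖ < 1) : Summable f := by
  obtain ⟨r, hlr, hr⟩ := exists_between hl
  refine summable_of_ratio_norm_eventually_le hr ?_
  filter_upwards [hc.norm.eventually_le_const hlr] with n hn
  rw [hf, norm_mul]
  gcongr

theorem tendsto_pow_zero {q : ℂ} (hq : ‖q‖ < 1) : Tendsto (fun n : ℕ => q ^ n) atTop (𝓝 0) :=
  tendsto_pow_atTop_nhds_zero_of_norm_lt_one hq

theorem choose_two_succ (n : ℕ) : (n + 1).choose 2 = n + n.choose 2 := by
  rw [Nat.choose_succ_succ' n 1, Nat.choose_one_right]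

theorem summable_thetaTerm {q : ℂ} (hq : ‖q‖ < 1) (x : ℂ) : Summable (thetaTerm q x) := by
  refine summable_of_ratio_tendsto (c := fun n => -x * q ^ n) (l := -x * 0) (fun n => ?_)
    ((tendsto_pow_zero hq).const_mul _) (by simp)
  simp only [thetaTerm, choose_two_succ]
  ring

theorem continuous_theta {q : ℂ} (hq : ‖q‖ < 1) : Continuous (theta q) := by
  refine continuous_iff_continuousAt.2 fun a => ?_
  have h : ContinuousOn (theta q) (Metric.ball 0 (‖a‖ + 1)) := by
    refine continuousOn_tsum (fun n => ?_)
      (summable_thetaTerm hq ((‖a‖ + 1 : ℝ) : ℂ)).norm fun n x hx => ?_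
    · unfold thetaTerm
      fun_prop
    · have hx' : ‖x‖ ≤ ‖a‖ + 1 := (mem_ball_zero_iff.1 hx).le
      have ha : ‖((‖a‖ + 1 : ℝ) : ℂ)‖ = ‖a‖ + 1 := by
        rw [Complex.norm_real, Real.norm_of_nonneg (by positivity)]
      simp only [thetaTerm, norm_mul, norm_pow, ha]
      gcongr
  exact h.continuousAt (Metric.isOpen_ball.mem_nhds (by simp))

theorem tendsto_one_sub_pow {q : ℂ} (hq : ‖q‖ < 1) :
    Tendsto (fun n : ℕ => 1 - q ^ (n + 1)) atTop (𝓝 1) := by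
  simpa using ((tendsto_pow_zero hq).comp (tendsto_add_atTop_nat 1)).const_sub 1

theorem summable_pow_div_qfac {q : ℂ} (hq : ‖q‖ < 1) {y : ℂ} (hy : ‖y‖ < 1) :
    Summable (fun n => y ^ n / qfac q q n) := by
  refine summable_of_ratio_tendsto (c := fun n => y / (1 - q ^ (n + 1))) (l := y / 1) (fun n => ?_)
    (tendsto_const_nhds.div (tendsto_one_sub_pow hq) one_ne_zero) (by simpa)
  rw [qfac_succ, ← pow_succ', pow_succ, div_mul_div_comm, mul_comm (qfac q q n), mul_comm y]

theorem summable_gauss_div_qfac {q : ℂ} (hq : ‖q‖ < 1) (y : ℂ) :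
    Summable (fun n => y ^ n * q ^ n.choose 2 / qfac q q n) := by
  refine summable_of_ratio_tendsto (c := fun n => y * q ^ n / (1 - q ^ (n + 1)))
    (l := y * 0 / 1) (fun n => ?_)
    (((tendsto_pow_zero hq).const_mul y).div (tendsto_one_sub_pow hq) one_ne_zero) (by simp)
  rw [qfac_succ, ← pow_succ', choose_two_succ, div_mul_div_comm, mul_comm (qfac q q n)]
  ring

/-! ### Infinite products and Euler's expansions -/

/-- A power series along `y q^N` tends to its constant term. -/
theorem tendsto_tsum_mul_pow {q : ℂ} (hq : ‖q‖ < 1) {c : ℕ → ℂ} {y : ℂ}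
    (h : Summable (fun n => c n * y ^ n)) :
    Tendsto (fun N : ℕ => ∑' n, c n * (y * q ^ N) ^ n) atTop (𝓝 (c 0)) := by
  have ht : ∑' n, (if n = 0 then c 0 else 0) = c 0 := tsum_ite_eq 0 fun _ => c 0
  rw [← ht]
  refine tendsto_tsum_of_dominated_convergence h.norm (fun n => ?_) (Eventually.of_forall ?_)
  · rcases eq_or_ne n 0 with rfl | hn
    · simp
    · have := ((tendsto_pow_zero hq).const_mul y).pow n |>.const_mul (c n)
      simpa [hn] using this
  · intro N n
    rw [norm_mul, norm_mul, norm_pow, norm_pow, norm_mul]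
    gcongr
    refine mul_le_of_le_one_right (norm_nonneg _) ?_
    rw [norm_pow]
    exact pow_le_one₀ (norm_nonneg _) hq.le

theorem tendsto_qfac {q : ℂ} (hq : ‖q‖ < 1) (x : ℂ) :
    Tendsto (qfac x q) atTop (𝓝 (qfacInf x q)) :=
  (multipliable_qfacInf x q hq).tendsto_prod_tprod_nat

theorem qfacInf_eq_mul {q : ℂ} (hq : ‖q‖ < 1) (x : ℂ) (n : ℕ) :
    qfacInf x q = qfac x q n * qfacInf (x * q ^ n) q := by
  have h1 := (tendsto_qfac hq x).comp (tendsto_add_atTop_nat n)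
  have h2 := (tendsto_qfac hq (x * q ^ n)).const_mul (qfac x q n)
  refine tendsto_nhds_unique h1 (h2.congr fun m => ?_)
  rw [Function.comp_apply, add_comm m n, qfac_add]

theorem qfacInf_ne_zero {q : ℂ} (hq : ‖q‖ < 1) {x : ℂ} (hx : ∀ i : ℕ, x * q ^ i ≠ 1) :
    qfacInf x q ≠ 0 := by
  have h : Summable (fun i : ℕ => ‖-(x * q ^ i)‖) := by
    simpa [norm_mul, norm_pow] using
      (summable_geometric_of_lt_one (norm_nonneg q) hq).mul_left ‖x‖
  have := tprod_one_add_ne_zero_of_summable (f := fun i : ℕ => -(x * q ^ i))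
    (fun i => by rw [← sub_eq_add_neg]; exact sub_ne_zero.2 (hx i).symm) h
  simpa [qfacInf, sub_eq_add_neg] using this

theorem qfacInf_mul_qfacInf_neg {q : ℂ} (hq : ‖q‖ < 1) (x : ℂ) :
    qfacInf x q * qfacInf (-x) q = qfacInf (x ^ 2) (q ^ 2) := by
  rw [qfacInf, qfacInf, ← (multipliable_qfacInf x q hq).tprod_mul (multipliable_qfacInf (-x) q hq)]
  refine tprod_congr fun i => ?_
  ring

/-- Euler's expansion of `(y; q)_∞`. -/
theorem hasSum_qfacInf {q : ℂ} (hq : ‖q‖ < 1) (y : ℂ) :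
    HasSum (fun n => (-y) ^ n * q ^ n.choose 2 / qfac q q n) (qfacInf y q) := by
  set c : ℕ → ℂ := fun n => (-1) ^ n * q ^ n.choose 2 / qfac q q n
  have hc : ∀ y : ℂ, (fun n => (-y) ^ n * q ^ n.choose 2 / qfac q q n) =
      fun n => c n * y ^ n := by
    intro y
    ext n
    rw [neg_pow]
    ring
  have hs : ∀ y : ℂ, Summable fun n => c n * y ^ n := fun y => by
    rw [← hc]
    exact summable_gauss_div_qfac hq (-y)
  -- The functional equation $f(y)=(1-y)f(yq)$; iterated, it gives the product because
  -- $f(yq^N)\to1$.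
  have hstep : ∀ y : ℂ, ∑' n, c n * y ^ n = (1 - y) * ∑' n, c n * (y * q) ^ n := by
    intro y
    have h1 : HasSum (fun n => c n * y ^ n - c n * (y * q) ^ n)
        (∑' n, c n * y ^ n - ∑' n, c n * (y * q) ^ n) := (hs y).hasSum.sub (hs _).hasSum
    have h2 : HasSum (fun n => -y * (c n * (y * q) ^ n)) (-y * ∑' n, c n * (y * q) ^ n) :=
      (hs (y * q)).hasSum.mul_left _
    rw [← hasSum_nat_add_iff' 1] at h1
    have h3 := h1.unique (h2.congr_fun fun n => ?_)
    · simp at h3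
      linear_combination h3
    · have h4 := qfac_self_ne_zero hq n
      have h5 := one_sub_pow_ne_zero hq n.succ_ne_zero
      simp only [c, qfac_succ, ← pow_succ', choose_two_succ]
      field_simp
      ring
  have hN : ∀ N : ℕ, ∑' n, c n * y ^ n = qfac y q N * ∑' n, c n * (y * q ^ N) ^ n := by
    intro N
    induction N with
    | zero => simp [qfac_zero]
    | succ N ih => rw [ih, qfac_succ, hstep (y * q ^ N), mul_assoc y, ← pow_succ, mul_assoc]
  have hlim := (tendsto_qfac hq y).mul (tendsto_tsum_mul_pow hq (hs y))
  simp only [← hN] at hlim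
  have h := tendsto_nhds_unique tendsto_const_nhds hlim
  have hc0 : c 0 = 1 := by simp [c, qfac_zero]
  rw [hc, ← mul_one (qfacInf y q), ← hc0, ← h]
  exact (hs y).hasSum

/-- Euler's expansion of `1 / (y; q)_∞`. -/
theorem hasSum_inv_qfacInf {q : ℂ} (hq : ‖q‖ < 1) {y : ℂ} (hy : ‖y‖ < 1) :
    HasSum (fun n => y ^ n / qfac q q n) (qfacInf y q)⁻¹ := by
  set c : ℕ → ℂ := fun n => (qfac q q n)⁻¹
  have hc : ∀ y : ℂ, (fun n => y ^ n / qfac q q n) = fun n => c n * y ^ n := by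
    intro y
    ext n
    exact div_eq_inv_mul _ _
  have hs : ∀ y : ℂ, ‖y‖ < 1 → Summable fun n => c n * y ^ n := fun y hy => by
    rw [← hc]
    exact summable_pow_div_qfac hq hy
  have hyN : ∀ N : ℕ, ‖y * q ^ N‖ < 1 := by
    intro N
    rw [norm_mul, norm_pow]
    exact mul_lt_one_of_nonneg_of_lt_one_left (norm_nonneg y) hy
      (pow_le_one₀ (norm_nonneg q) hq.le)
  have hstep : ∀ y : ℂ, ‖y‖ < 1 → ‖y * q‖ < 1 →
      (1 - y) * ∑' n, c n * y ^ n = ∑' n, c n * (y * q) ^ n := by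
    intro y hy hyq
    have h1 : HasSum (fun n => c n * y ^ n - c n * (y * q) ^ n)
        (∑' n, c n * y ^ n - ∑' n, c n * (y * q) ^ n) := (hs y hy).hasSum.sub (hs _ hyq).hasSum
    have h2 : HasSum (fun n => y * (c n * y ^ n)) (y * ∑' n, c n * y ^ n) :=
      (hs y hy).hasSum.mul_left _
    rw [← hasSum_nat_add_iff' 1] at h1
    have h3 := h1.unique (h2.congr_fun fun n => ?_)
    · simp at h3
      linear_combination h3
    · have h4 := qfac_self_ne_zero hq n
      have h5 := one_sub_pow_ne_zero hq n.succ_ne_zero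
      simp only [c, qfac_succ, ← pow_succ']
      field_simp
      ring
  have hN : ∀ N : ℕ, qfac y q N * ∑' n, c n * y ^ n = ∑' n, c n * (y * q ^ N) ^ n := by
    intro N
    induction N with
    | zero => simp [qfac_zero]
    | succ N ih =>
      have h := hyN (N + 1)
      rw [pow_succ, ← mul_assoc] at h
      rw [qfac_succ, mul_right_comm, ih, mul_comm, hstep _ (hyN N) h, mul_assoc y, ← pow_succ]
  have hlim := (tendsto_qfac hq y).mul_const (∑' n, c n * y ^ n)
  simp only [hN] at hlim
  have h := tendsto_nhds_unique hlim (tendsto_tsum_mul_pow hq (hs y hy))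
  have hc0 : c 0 = 1 := by simp [c, qfac_zero]
  rw [hc, inv_eq_of_mul_eq_one_right (h.trans hc0)]
  exact (hs y hy).hasSum

/-! ### The triple series -/

theorem hasSum_antidiagonal {f : ℕ × ℕ → ℂ} {s : ℂ} (hf : HasSum f s) :
    HasSum (fun n => ∑ p ∈ Finset.HasAntidiagonal.antidiagonal n, f p) s := by
  refine ((Finset.HasAntidiagonal.sigmaAntidiagonalEquivProd.hasSum_iff).2 hf).sigma fun n => ?_
  exact Finset.hasSum (Finset.HasAntidiagonal.antidiagonal n) f

theorem hasSum_of_eq {f : ℕ → ℂ} {s t : ℂ} (h : HasSum f s) (hst : s = t) : HasSum f t :=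
  hst ▸ h

theorem norm_pow_lt_one {q : ℂ} (hq : ‖q‖ < 1) {n : ℕ} (hn : n ≠ 0) : ‖q ^ n‖ < 1 := by
  rw [norm_pow]
  exact pow_lt_one₀ (norm_nonneg q) hq hn

/-- The summand of the triple series obtained by expanding every factor of `P_m(a, -a)`. -/
def tripleTerm (q z w : ℂ) (i j m : ℕ) : ℂ :=
  (-z) ^ i * (q ^ 2) ^ i.choose 2 / qfac (q ^ 2) (q ^ 2) i *
    (w ^ j * q ^ j.choose 2 / qfac q q j) * (q ^ ((j + m) * (j + 2 * i + 1)) / qfac q q m)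

/-- Since $(j+m)(j+2i+1)\ge m$, a product of three convergent series dominates, with no bound on $z$
or $w$. -/
theorem summable_tripleTerm {q : ℂ} (hq : ‖q‖ < 1) (z w : ℂ) :
    Summable (fun p : (ℕ × ℕ) × ℕ => tripleTerm q z w p.1.1 p.1.2 p.2) := by
  have h1 := (summable_gauss_div_qfac (norm_sq_lt_one hq) (-z)).norm
  have h2 := (summable_gauss_div_qfac hq w).norm
  have h3 := (summable_pow_div_qfac hq hq).norm
  have h12 := h1.mul_of_nonneg h2 (fun _ => norm_nonneg _) fun _ => norm_nonneg _
  refine .of_norm_bounded (h12.mul_of_nonneg h3 (fun _ => by positivity)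
    fun _ => norm_nonneg _) ?_
  rintro ⟨⟨i, j⟩, m⟩
  simp only [tripleTerm]
  rw [norm_mul, norm_mul, norm_div (q ^ ((j + m) * (j + 2 * i + 1))), norm_div (q ^ m),
    norm_pow q, norm_pow q m]
  gcongr ?_ * (?_ / ?_)
  refine pow_le_pow_of_le_one (norm_nonneg q) hq.le ?_
  nlinarith [Nat.zero_le ((j + m) * (j + 2 * i))]

/-- The sum over $m$ is $1/(q^{j+2i+1};q)_\infty$, which $(q;q)_\infty$ turns into a finite
factorial. -/
theorem hasSum_tripleTerm_third {q : ℂ} (hq : ‖q‖ < 1) (z w : ℂ) (i j : ℕ) :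
    HasSum (fun m => qfacInf q q * tripleTerm q z w i j m)
      ((-z) ^ i * (q ^ 2) ^ i.choose 2 * (w ^ j * q ^ j.choose 2) *
        q ^ (j * (j + 2 * i + 1)) *
        (qfac q q (j + 2 * i) / (qfac (q ^ 2) (q ^ 2) i * qfac q q j))) := by
  have hn := norm_pow_lt_one hq (j + 2 * i).succ_ne_zero
  have h := hasSum_inv_qfacInf hq hn
  have h0 : qfacInf (q ^ (j + 2 * i + 1)) q ≠ 0 := qfacInf_ne_zero hq fun k hk => by
    rw [← pow_add] at hk
    exact one_sub_pow_ne_zero hq (by omega) (sub_eq_zero.2 hk.symm)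
  have hs : qfacInf q q = qfac q q (j + 2 * i) * qfacInf (q ^ (j + 2 * i + 1)) q := by
    rw [qfacInf_eq_mul hq q (j + 2 * i), ← pow_succ']
  have h' := h.mul_left (qfacInf q q * ((-z) ^ i * (q ^ 2) ^ i.choose 2 /
    qfac (q ^ 2) (q ^ 2) i * (w ^ j * q ^ j.choose 2 / qfac q q j)) * q ^ (j * (j + 2 * i + 1)))
  refine hasSum_of_eq (h'.congr_fun fun m => ?_) ?_
  · rw [tripleTerm, add_mul, pow_add, mul_comm m, pow_mul q (j + 2 * i + 1), Nat.succ_eq_add_one]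
    ring
  · have := qfac_self_ne_zero hq j
    have := qfac_self_ne_zero (norm_sq_lt_one hq) i
    rw [hs, Nat.succ_eq_add_one]
    field_simp

theorem hasSum_tripleTerm_first {q : ℂ} (hq : ‖q‖ < 1) (z w : ℂ) (j m : ℕ) :
    HasSum (fun i => tripleTerm q z w i j m)
      (w ^ j * q ^ j.choose 2 / qfac q q j / qfac q q m *
        (q ^ ((j + m) * (j + 1)) * qfacInf (z * q ^ (2 * (j + m))) (q ^ 2))) := by
  have h := hasSum_qfacInf (norm_sq_lt_one hq) (z * q ^ (2 * (j + m)))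
  refine hasSum_of_eq ((h.mul_left (w ^ j * q ^ j.choose 2 / qfac q q j / qfac q q m *
    q ^ ((j + m) * (j + 1)))).congr_fun fun i => ?_) ?_
  · rw [tripleTerm, show (j + m) * (j + 2 * i + 1) = (j + m) * (j + 1) + 2 * (j + m) * i by ring,
      pow_add, pow_mul q (2 * (j + m)), ← neg_mul, mul_pow (-z)]
    ring
  · ring

/-- The same triple series summed in two orders. -/
theorem exists_hasSum_tripleTerm {q : ℂ} (hq : ‖q‖ < 1) (z w : ℂ) :
    ∃ s : ℂ,
      HasSum (fun n => q ^ n / qfac q q n * qfac (-(w * q ^ n)) q n *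
        qfacInf (z * q ^ (2 * n)) (q ^ 2)) s ∧
      HasSum (fun k => ∑ p ∈ Finset.HasAntidiagonal.antidiagonal k,
        (-z) ^ p.1 * (q ^ 2) ^ p.1.choose 2 * (w ^ p.2 * q ^ p.2.choose 2) *
          q ^ (p.2 * (p.2 + 2 * p.1 + 1)) *
          (qfac q q (p.2 + 2 * p.1) / (qfac (q ^ 2) (q ^ 2) p.1 * qfac q q p.2)))
        (qfacInf q q * s) := by
  have hsum := (summable_tripleTerm hq z w).hasSum
  refine ⟨_, ?_, hasSum_antidiagonal ((hsum.mul_left (qfacInf q q)).prod_fiberwise fun p =>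
    hasSum_tripleTerm_third hq z w p.1 p.2)⟩
  -- Makes $i$ the innermost index, so that $(j,m)$ can then be grouped by $n=j+m$.
  let e : (ℕ × ℕ) × ℕ ≃ (ℕ × ℕ) × ℕ :=
    ⟨fun p => ((p.2, p.1.1), p.1.2), fun p => ((p.1.2, p.2), p.1.1), fun _ => rfl, fun _ => rfl⟩
  have h := hasSum_antidiagonal ((e.hasSum_iff.2 hsum).prod_fiberwise fun p =>
    hasSum_tripleTerm_first hq z w p.1 p.2)
  refine h.congr_fun fun n => ?_
  have hb := sum_antidiagonal_qbinomial hq (w * q ^ n) n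
  rw [div_mul_eq_mul_div, mul_div_assoc, ← hb, mul_right_comm, Finset.mul_sum]
  refine Finset.sum_congr rfl fun p hp => ?_
  rw [Finset.HasAntidiagonal.mem_antidiagonal.1 hp, mul_pow, ← pow_mul]
  ring

/-- The choice $w=z/q^4$ makes each group $i+j=k$ a multiple of $z^k$. -/
theorem hasSum_coeff {q : ℂ} (hq0 : q ≠ 0) (hq : ‖q‖ < 1) (z : ℂ) :
    ∃ s : ℂ,
      HasSum (fun n => q ^ n / qfac q q n * qfac (-(z / q ^ 4 * q ^ n)) q n *
        qfacInf (z * q ^ (2 * n)) (q ^ 2)) s ∧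
      HasSum (fun k : ℕ => z ^ k * (q ^ (2 * k ^ 2 + k) / q ^ (4 * k) *
        (q * (q ^ (2 * k))⁻¹ + 1 + q ^ 2 + q ^ (2 * k + 3))))
        ((1 + q) * (1 + q ^ 2) * (qfacInf q q * s)) := by
  obtain ⟨s, h1, h2⟩ := exists_hasSum_tripleTerm hq z (z / q ^ 4)
  refine ⟨s, h1, (h2.mul_left ((1 + q) * (1 + q ^ 2))).congr_fun fun k => ?_⟩
  rw [← sum_antidiagonal_coeff hq0 hq, mul_left_comm]
  congr 1
  rw [Finset.mul_sum]
  refine Finset.sum_congr rfl fun p hp => ?_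
  rw [← Finset.HasAntidiagonal.mem_antidiagonal.1 hp, neg_pow z, pow_add z, div_pow, ← pow_mul,
    ← pow_mul]
  ring

/-! ### Matching with the partial theta function -/

theorem theta_even_odd {q : ℂ} (hq : ‖q‖ < 1) (a : ℂ) :
    ∃ e o : ℂ, HasSum (fun n : ℕ => q ^ (2 * n).choose 2 * (a ^ 2) ^ n) e ∧
      HasSum (fun n : ℕ => q ^ (2 * n + 1).choose 2 * (a ^ 2) ^ n) o ∧
      theta q a = e - a * o ∧ theta q (-a) = e + a * o := by
  have hfun : ∀ b : ℂ, (fun n : ℕ => thetaTerm q b (2 * n)) =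
        (fun n : ℕ => q ^ (2 * n).choose 2 * (b ^ 2) ^ n) ∧
      (fun n : ℕ => thetaTerm q b (2 * n + 1)) =
        (fun n : ℕ => -b * (q ^ (2 * n + 1).choose 2 * (b ^ 2) ^ n)) := by
    intro b
    constructor <;> ext n
    · simp [thetaTerm, pow_mul]
    · simp [thetaTerm, pow_succ, pow_mul]
      ring
  have he : Summable fun n : ℕ => q ^ (2 * n).choose 2 * (a ^ 2) ^ n := by
    rw [← (hfun a).1]
    exact (summable_thetaTerm hq a).comp_injective (mul_right_injective₀ two_ne_zero)
  have ho : Summable fun n : ℕ => q ^ (2 * n + 1).choose 2 * (a ^ 2) ^ n := by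
    -- The odd series is obtained by dividing by $-a$; at $a=0$ only its first term survives.
    rcases eq_or_ne a 0 with rfl | ha
    · exact summable_of_ne_finset_zero (s := {0}) fun n hn => by simp_all
    · rw [← summable_mul_left_iff (neg_ne_zero.2 ha), ← (hfun a).2]
      exact (summable_thetaTerm hq a).comp_injective
        ((add_left_injective 1).comp (mul_right_injective₀ two_ne_zero))
  have key : ∀ b : ℂ, b ^ 2 = a ^ 2 → theta q b =
      ∑' n : ℕ, q ^ (2 * n).choose 2 * (a ^ 2) ^ n +
        -b * ∑' n : ℕ, q ^ (2 * n + 1).choose 2 * (a ^ 2) ^ n := by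
    intro b hb
    refine (HasSum.even_add_odd ?_ ?_).tsum_eq
    · rw [(hfun b).1, hb]
      exact he.hasSum
    · rw [(hfun b).2, hb]
      exact ho.hasSum.mul_left _
  refine ⟨_, _, he.hasSum, ho.hasSum, ?_, ?_⟩
  · rw [key a rfl]
    ring
  · rw [key (-a) (neg_sq a)]
    ring

theorem choose_two_even (n : ℕ) : (2 * n).choose 2 + n = 2 * n ^ 2 := by
  induction n with
  | zero => rfl
  | succ n ih =>
    rw [show 2 * (n + 1) = 2 * n + 1 + 1 by ring, choose_two_succ, choose_two_succ]
    linarith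

theorem theta_combination {q : ℂ} (hq0 : q ≠ 0) (hq : ‖q‖ < 1) (a s : ℂ)
    (hs : HasSum (fun k : ℕ => (a ^ 2) ^ k * (q ^ (2 * k ^ 2 + k) / q ^ (4 * k) *
        (q * (q ^ (2 * k))⁻¹ + 1 + q ^ 2 + q ^ (2 * k + 3)))) s) :
    (a ^ 2 - a * q - a * q ^ 3 + q ^ 5) / (2 * q ^ 2) * theta q a +
      (a ^ 2 + a * q + a * q ^ 3 + q ^ 5) / (2 * q ^ 2) * theta q (-a) + (1 + q + q ^ 2) = s := by
  obtain ⟨e, o, he, ho, h1, h2⟩ := theta_even_odd hq a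
  set z := a ^ 2
  have hE : ∀ n : ℕ, q ^ (2 * n).choose 2 * q ^ n = q ^ (2 * n ^ 2) := fun n => by
    rw [← pow_add, choose_two_even]
  -- Shifting $k=n+1$ turns $q^{2k^2-5k+1}$ and $q^{2k^2-3k}$ into the even and odd theta exponents.
  -- The unmatched $k=0$ term $1+q+q^2$ becomes the $+1$ after normalization.
  have hlow : HasSum (fun k : ℕ => z ^ k * (q ^ (2 * k ^ 2 + k) / q ^ (4 * k) *
      (q * (q ^ (2 * k))⁻¹ + 1 + q ^ 2))) (z / q ^ 2 * e + z * (1 + q ^ 2) / q * o +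
        (1 + q + q ^ 2)) := by
    rw [← hasSum_nat_add_iff' 1]
    refine hasSum_of_eq (((he.mul_left (z / q ^ 2)).add
      (ho.mul_left (z * (1 + q ^ 2) / q))).congr_fun fun n => ?_) ?_
    · have hn : q ^ n ≠ 0 := pow_ne_zero _ hq0
      have hC : q ^ (2 * n).choose 2 = q ^ (2 * n ^ 2) / q ^ n := by
        rw [← hE, mul_div_cancel_right₀ _ hn]
      rw [choose_two_succ, pow_add q (2 * n), hC,
        show 2 * (n + 1) ^ 2 + (n + 1) = 2 * n ^ 2 + 5 * n + 3 by ring]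
      simp only [pow_add, pow_mul', mul_add]
      field_simp
      ring
    · simp
      ring
  have hhigh := hlow.add (he.mul_left (q ^ 3))
  rw [h1, h2, ← (hhigh.congr_fun fun k => ?_).unique hs]
  · field_simp
    simp only [z]
    ring
  · have hk : q ^ k ≠ 0 := pow_ne_zero _ hq0
    have hC : q ^ (2 * k).choose 2 = q ^ (2 * k ^ 2) / q ^ k := by
      rw [← hE, mul_div_cancel_right₀ _ hk]
    rw [hC]
    simp only [pow_add, pow_mul']
    field_simp

/-! ### The identity at admissible points -/

theorem qfac_ne_zero {x q : ℂ} (h : ∀ i : ℕ, x * q ^ i ≠ 1) (n : ℕ) : qfac x q n ≠ 0 :=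
  Finset.prod_ne_zero_iff.2 fun i _ => sub_ne_zero.2 (h i).symm

/-- Uses $(x;q)_{2n}/(x;q)_n=(xq^n;q)_n$ and $(x;q)_\infty/(x;q)_n=(xq^n;q)_\infty$. -/
theorem PTerm_eq {q : ℂ} (hq : ‖q‖ < 1) {a : ℂ} (ha : Admissible q 4 a (-a)) (n : ℕ) :
    PTerm q 4 a (-a) n = (qfacInf a q * qfacInf (-a) q)⁻¹ *
      (q ^ n / qfac q q n * qfac (-(a ^ 2 / q ^ 4 * q ^ n)) q n *
        qfacInf (a ^ 2 * q ^ (2 * n)) (q ^ 2)) := by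
  have h1 := qfac_self_ne_zero hq n
  have h2 := qfac_ne_zero (fun i => (ha i).1) n
  have h3 := qfac_ne_zero (fun i => (ha i).2.1) n
  have h4 := qfac_ne_zero (fun i => (ha i).2.2) n
  have h5 := qfacInf_ne_zero hq fun i => (ha i).1
  have h6 := qfacInf_ne_zero hq fun i => (ha i).2.1
  have h7 : qfacInf (a ^ 2 * q ^ (2 * n)) (q ^ 2) =
      qfacInf (a * q ^ n) q * qfacInf (-a * q ^ n) q := by
    rw [neg_mul, qfacInf_mul_qfacInf_neg hq, mul_pow, ← pow_mul, mul_comm 2 n]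
  have h8 : -(a ^ 2 / q ^ 4 * q ^ n) = a * -a / q ^ 4 * q ^ n := by ring
  have h9 := qfacInf_eq_mul hq a n
  have h10 := qfacInf_eq_mul hq (-a) n
  rw [h9] at h5
  rw [h10] at h6
  have h11 := right_ne_zero_of_mul h5
  have h12 := right_ne_zero_of_mul h6
  rw [PTerm, h7, h8, two_mul, qfac_add, h9, h10]
  generalize qfacInf (-a * q ^ n) q = v at *
  generalize qfac (a * -a / q ^ 4) q n = u at *
  field_simp

theorem P_identity {q : ℂ} (hq0 : q ≠ 0) (hq : ‖q‖ < 1) {a : ℂ}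
    (ha : Admissible q 4 a (-a)) :
    Summable (PTerm q 4 a (-a)) ∧
      (a ^ 2 - a * q - a * q ^ 3 + q ^ 5) / (2 * q ^ 2) * theta q a +
        (a ^ 2 + a * q + a * q ^ 3 + q ^ 5) / (2 * q ^ 2) * theta q (-a) + (1 + q + q ^ 2) =
      (1 + q) * (1 + q ^ 2) * P q 4 a (-a) := by
  obtain ⟨s, h1, h2⟩ := hasSum_coeff hq0 hq (a ^ 2)
  have h : HasSum (PTerm q 4 a (-a)) ((qfacInf a q * qfacInf (-a) q)⁻¹ * s) :=
    (h1.mul_left _).congr_fun (PTerm_eq hq ha)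
  refine ⟨h.summable, ?_⟩
  have h5 := qfacInf_ne_zero hq fun i => (ha i).1
  have h6 := qfacInf_ne_zero hq fun i => (ha i).2.1
  rw [theta_combination hq0 hq a _ h2, P, h.tsum_eq]
  field_simp

theorem one_add_add_sq_ne_zero {q : ℂ} (hq : ‖q‖ < 1) : 1 + q + q ^ 2 ≠ 0 := by
  have h := one_sub_pow_ne_zero hq three_ne_zero
  rw [show 1 - q ^ 3 = (1 + q + q ^ 2) * (1 - q) by ring] at h
  exact left_ne_zero_of_mul h

theorem P_identity_normalized {q : ℂ} (hq : ‖q‖ < 1) (hq0 : q ≠ 0) {a t u l : ℂ}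
    (h : (a ^ 2 - a * q - a * q ^ 3 + q ^ 5) / (2 * q ^ 2) * t +
        (a ^ 2 + a * q + a * q ^ 3 + q ^ 5) / (2 * q ^ 2) * u + (1 + q + q ^ 2) =
      (1 + q) * (1 + q ^ 2) * l) :
    (a ^ 2 - a * q - a * q ^ 3 + q ^ 5) / (2 * q ^ 2 * (1 + q + q ^ 2)) * t +
        (a ^ 2 + a * q + a * q ^ 3 + q ^ 5) / (2 * q ^ 2 * (1 + q + q ^ 2)) * u + 1 =
      (1 + q) * (1 + q ^ 2) / (1 + q + q ^ 2) * l := by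
  have h3 := one_add_add_sq_ne_zero hq
  rw [div_mul_eq_mul_div _ _ l, ← h]
  field_simp

/-! ### Exceptional points as limits -/

theorem eventually_polynomial_ne (p : Polynomial ℂ) (hp : p ≠ 0) (a : ℂ) :
    ∀ᶠ x in 𝓝[≠] a, p.eval x ≠ 0 := by
  have hfin : {x : ℂ | p.IsRoot x}.Finite := Polynomial.finite_setOfPred_isRoot hp
  have h : ({x : ℂ | p.IsRoot x} \ {a})ᶜ ∈ 𝓝 a :=
    (hfin.subset Set.sdiff_subset).isClosed.isOpen_compl.mem_nhds (by simp)
  filter_upwards [mem_nhdsWithin_of_mem_nhds h, self_mem_nhdsWithin] with x hx hxa h0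
  exact hx ⟨h0, hxa⟩

/-- A continuous multiple of `q^i` is eventually uniformly far from `1`. -/
theorem eventually_forall_mul_pow_ne_one {q : ℂ} (hq0 : q ≠ 0) (hq : ‖q‖ < 1)
    (p : Polynomial ℂ) (hp : 0 < p.natDegree) (a : ℂ) :
    ∀ᶠ x in 𝓝[≠] a, ∀ i : ℕ, p.eval x * q ^ i ≠ 1 := by
  have hlim : Tendsto (fun i : ℕ => (‖p.eval a‖ + 1) * ‖q ^ i‖) atTop (𝓝 0) := by
    simpa using (tendsto_pow_zero hq).norm.const_mul (‖p.eval a‖ + 1)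
  -- Beyond $N$ the product has norm below $1$ near $a$; each of the finitely many earlier $i$
  -- excludes only roots of a nonzero polynomial.
  obtain ⟨N, hN⟩ := eventually_atTop.1 (hlim.eventually_lt_const one_pos)
  have hsmall : ∀ᶠ x in 𝓝[≠] a, ‖p.eval x‖ < ‖p.eval a‖ + 1 :=
    mem_nhdsWithin_of_mem_nhds (p.continuous.norm.continuousAt.eventually_lt_const (by simp))
  have hfirst : ∀ᶠ x in 𝓝[≠] a, ∀ i ∈ Finset.range N, p.eval x * q ^ i ≠ 1 := by
    refine (Finset.eventually_all _).2 fun i _ => ?_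
    have hi : q ^ i ≠ 0 := pow_ne_zero _ hq0
    have hne : p - Polynomial.C (q ^ i)⁻¹ ≠ 0 := by
      rintro h
      rw [sub_eq_zero.1 h, Polynomial.natDegree_C] at hp
      exact hp.false
    filter_upwards [eventually_polynomial_ne _ hne a] with x hx h1
    refine hx ?_
    rw [Polynomial.eval_sub, Polynomial.eval_C, sub_eq_zero]
    exact eq_inv_of_mul_eq_one_left h1
  filter_upwards [hsmall, hfirst] with x hx hxi i h1
  rcases lt_or_ge i N with hi | hi
  · exact hxi i (Finset.mem_range.2 hi) h1
  · have h2 := hN i hi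
    have h3 : ‖p.eval x‖ * ‖q ^ i‖ = 1 := by rw [← norm_mul, h1, norm_one]
    have h4 : ‖p.eval x‖ * ‖q ^ i‖ ≤ (‖p.eval a‖ + 1) * ‖q ^ i‖ := by gcongr
    linarith

theorem eventually_admissible {q : ℂ} (hq0 : q ≠ 0) (hq : ‖q‖ < 1) (m : ℕ) (a : ℂ) :
    ∀ᶠ x in 𝓝[≠] a, Admissible q m x (-x) := by
  have hm : -(q ^ m)⁻¹ ≠ 0 := neg_ne_zero.2 (inv_ne_zero (pow_ne_zero _ hq0))
  filter_upwards [eventually_forall_mul_pow_ne_one hq0 hq Polynomial.X (by simp) a,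
    eventually_forall_mul_pow_ne_one hq0 hq (-Polynomial.X) (by simp) a,
    eventually_forall_mul_pow_ne_one hq0 hq (Polynomial.C (-(q ^ m)⁻¹) * Polynomial.X ^ 2)
      (by rw [Polynomial.natDegree_C_mul_X_pow _ _ hm]; exact two_pos) a] with x h1 h2 h3 i
  refine ⟨by simpa using h1 i, by simpa using h2 i, fun h => h3 i ?_⟩
  rw [← h]
  simp only [Polynomial.eval_mul, Polynomial.eval_C, Polynomial.eval_pow, Polynomial.eval_X]
  ring

end PartialThetaId

end

theorem mainTheorem11 (q : ℂ) (hq0 : q ≠ 0) (hq1 : ‖q‖ < 1) :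
    (∀ x : ℂ, Summable (PartialThetaId.thetaTerm q x)) ∧
    (∀ a : ℂ, PartialThetaId.Admissible q 4 a (-a) →
      Summable (PartialThetaId.PTerm q 4 a (-a)) ∧
      (a ^ 2 - a * q - a * q ^ 3 + q ^ 5) / (2 * q ^ 2 * (1 + q + q ^ 2)) *
            PartialThetaId.theta q a +
          (a ^ 2 + a * q + a * q ^ 3 + q ^ 5) / (2 * q ^ 2 * (1 + q + q ^ 2)) *
            PartialThetaId.theta q (-a) + 1 =
        (1 + q) * (1 + q ^ 2) / (1 + q + q ^ 2) * PartialThetaId.P q 4 a (-a)) ∧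
    (∀ a : ℂ,
      (∀ᶠ x in 𝓝[≠] a, PartialThetaId.Admissible q 4 x (-x)) ∧
      ∃ l : ℂ, Tendsto (fun x : ℂ => PartialThetaId.P q 4 x (-x)) (𝓝[≠] a) (𝓝 l) ∧
        (a ^ 2 - a * q - a * q ^ 3 + q ^ 5) / (2 * q ^ 2 * (1 + q + q ^ 2)) *
              PartialThetaId.theta q a +
            (a ^ 2 + a * q + a * q ^ 3 + q ^ 5) / (2 * q ^ 2 * (1 + q + q ^ 2)) *
              PartialThetaId.theta q (-a) + 1 =
          (1 + q) * (1 + q ^ 2) / (1 + q + q ^ 2) * l) := by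
  open PartialThetaId in
  refine ⟨summable_thetaTerm hq1, fun a ha => ?_, fun a => ?_⟩
  · obtain ⟨h1, h2⟩ := P_identity hq0 hq1 ha
    exact ⟨h1, P_identity_normalized hq1 hq0 h2⟩
  · have hev := eventually_admissible hq0 hq1 4 a
    have hD : (1 + q) * (1 + q ^ 2) ≠ 0 :=
      mul_ne_zero (by simpa using one_add_pow_ne_zero hq1 one_ne_zero)
        (one_add_pow_ne_zero hq1 two_ne_zero)
    -- The theta side solved for $P_4$: continuous everywhere, so its value at $a$ is the limit.
    let F : ℂ → ℂ := fun x =>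
      ((x ^ 2 - x * q - x * q ^ 3 + q ^ 5) / (2 * q ^ 2) * theta q x +
        (x ^ 2 + x * q + x * q ^ 3 + q ^ 5) / (2 * q ^ 2) * theta q (-x) + (1 + q + q ^ 2)) /
        ((1 + q) * (1 + q ^ 2))
    have hF : Continuous F := by
      have hθ := continuous_theta hq1
      fun_prop
    refine ⟨hev, F a, ((hF.tendsto a).mono_left nhdsWithin_le_nhds).congr' ?_,
      P_identity_normalized hq1 hq0 (mul_div_cancel₀ _ hD).symm⟩
    filter_upwards [hev] with x hx
    exact div_eq_of_eq_mul hD ((P_identity hq0 hq1 hx).2.trans (mul_comm _ _))
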